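/- Let $\Omega\subset\mathbb{R}^2$ be a bounded, connected (non-empty) open set, let $x_{\min}=\inf_{(x,y)\in\Omega}x$, and assume that there is exactly one point $A_0\in\partial\Omega$ whose first coordinate equals $x_{\min}$. For $h>0$ let $\mathscr{L}_h=-h^2\Delta+x$ be the Dirichlet realization of the Stark Hamiltonian, that is, the self-adjoint operator on $L^2(\Omega)=L^2(\Omega;\mathbb{C})$ associated with the quadratic form $$\mathscr{Q}_h(\varphi)=h^2\int_\Omega|\nabla\varphi|^2\,\mathrm{d}\mathbf{x}+\int_\Omega x\,|\varphi|^2\,\mathrm{d}\mathbf{x},\qquad \varphi\in H^1_0(\Omega).$$ Let $M,\eta>0$. Then there exist $c_\eta,C_\eta,h_0>0$ such that, for every $h\in(0,h_0)$, every eigenvalue $\lambda$ of $\mathscr{L}_h$ with $\lambda\le x_{\min}+Mh^{2/3}$ and every eigenfunction $\psi$ of $\mathscr{L}_h$ corresponding to $\lambda$, $$\int_{\Omega\setminus B(A_0,\eta)}|\psi|^2\,\mathrm{d}\mathbf{x}\le C_\eta e^{-c_\eta/h}\|\psi\|^2 \qquad\text{and}\qquad \int_{\Omega\setminus B(A_0,\eta)}|\nabla\psi|^2\,\mathrm{d}\mathbf{x}\le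 C_\eta e^{-c_\eta/h}\|\psi\|^2,$$ where $B(A_0,\eta)$ is the open disc of radius $\eta$ centred at $A_0$ and $\|\cdot\|$ is the norm of $L^2(\Omega)$. (The result holds in particular if, in addition, $\partial\Omega$ is smooth near $A_0$ with positive curvature at $A_0$; this is not needed.) -/

import Mathlib

open MeasureTheory TopologicalSpace
open scoped ENNReal ContDiff Distributions InnerProductSpace ComplexConjugate

noncomputable section

namespace Stark

/-- The Euclidean plane; the point `(x, y)` has coordinates `P 0 = x` and `P 1 = y`. -/
abbrev Plane : Type := EuclideanSpace ℝ (Fin 2)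

/-- `L²(Ω; ℂ)`, with respect to Lebesgue measure on `Ω`. -/
abbrev L2 (Ω : Opens Plane) : Type :=
  Lp ℂ 2 ((volume : Measure Plane).restrict (Ω : Set Plane))

/-- `L²(Ω; ℂ²)`, square integrable vector fields on `Ω`. -/
abbrev L2Vec (Ω : Opens Plane) : Type :=
  Lp (EuclideanSpace ℂ (Fin 2)) 2 ((volume : Measure Plane).restrict (Ω : Set Plane))

/-- The unit vector of the `i`-th coordinate axis. -/
def axis (i : Fin 2) : Plane := EuclideanSpace.single i (1 : ℝ)

/-- The classical gradient `(∂ₓ f, ∂_y f)` of a complex-valued function on the plane. -/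
def classicalGrad (f : Plane → ℂ) (P : Plane) : EuclideanSpace ℂ (Fin 2) :=
  WithLp.toLp 2 (fun i => fderiv ℝ f P (axis i))

variable {Ω : Opens Plane}

lemma continuous_fderiv_axis (φ : 𝓓(Ω, ℂ)) (i : Fin 2) :
    Continuous (fun P => fderiv ℝ φ P (axis i)) :=
  (φ.contDiff.continuous_fderiv (by simp)).clm_apply continuous_const

lemma hasCompactSupport_fderiv_axis (φ : 𝓓(Ω, ℂ)) (i : Fin 2) :
    HasCompactSupport (fun P => fderiv ℝ φ P (axis i)) :=
  φ.hasCompactSupport.fderiv_apply ℝ (axis i)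

lemma memLp_testFunction (φ : 𝓓(Ω, ℂ)) :
    MemLp φ 2 ((volume : Measure Plane).restrict (Ω : Set Plane)) :=
  (φ.continuous.memLp_of_hasCompactSupport φ.hasCompactSupport).restrict _

lemma memLp_classicalGrad (φ : 𝓓(Ω, ℂ)) :
    MemLp (classicalGrad φ) 2 ((volume : Measure Plane).restrict (Ω : Set Plane)) := by
  have hc : Continuous (classicalGrad φ) :=
    (PiLp.continuous_toLp 2 _).comp (continuous_pi fun i => continuous_fderiv_axis φ i)
  have hs : HasCompactSupport (classicalGrad φ) := by
    refine φ.hasCompactSupport.of_isClosed_subset (isClosed_tsupport _) ?_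
    refine closure_minimal (fun P hP => ?_) (isClosed_tsupport _)
    by_contra hn
    apply hP
    have h0 : fderiv ℝ φ P = 0 := by
      by_contra h1
      exact hn (support_fderiv_subset ℝ h1)
    ext i
    simp [classicalGrad, h0]
  exact (hc.memLp_of_hasCompactSupport hs).restrict _

/-- The linear map `φ ↦ (φ, ∇φ)` from test functions to `L²(Ω; ℂ) × L²(Ω; ℂ²)`. -/
def testPair (Ω : Opens Plane) : 𝓓(Ω, ℂ) →ₗ[ℂ] L2 Ω × L2Vec Ω where
  toFun φ := ((memLp_testFunction φ).toLp φ, (memLp_classicalGrad φ).toLp (classicalGrad φ))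
  map_add' φ ψ := by
    refine Prod.ext ?_ ?_
    · rw [Prod.fst_add, ← MemLp.toLp_add]
      rfl
    · rw [Prod.snd_add, ← MemLp.toLp_add]
      refine MemLp.toLp_congr (memLp_classicalGrad (φ + ψ)) _ (Filter.Eventually.of_forall fun P => ?_)
      have h1 : DifferentiableAt ℝ φ P := φ.contDiff.differentiable (by simp) P
      have h2 : DifferentiableAt ℝ ψ P := ψ.contDiff.differentiable (by simp) P
      ext i
      simp [classicalGrad, fderiv_add h1 h2]
  map_smul' c φ := by
    refine Prod.ext ?_ ?_
    · rw [RingHom.id_apply, Prod.smul_fst, ← MemLp.toLp_const_smul]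
      rfl
    · rw [RingHom.id_apply, Prod.smul_snd, ← MemLp.toLp_const_smul]
      refine MemLp.toLp_congr (memLp_classicalGrad (c • φ)) _ (Filter.Eventually.of_forall fun P => ?_)
      have h1 : DifferentiableAt ℝ φ P := φ.contDiff.differentiable (by simp) P
      ext i
      simp [classicalGrad, fderiv_const_smul h1]

/-- `g` is the weak gradient of `u` on `Ω`: `∫_Ω u ∂ᵢφ = -∫_Ω gᵢ φ` for all test functions. -/
def IsWeakGrad (u : L2 Ω) (g : L2Vec Ω) : Prop :=
  ∀ (φ : 𝓓(Ω, ℂ)) (i : Fin 2),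
    ∫ P in (Ω : Set Plane), u P * fderiv ℝ φ P (axis i)
      = -∫ P in (Ω : Set Plane), g P i * φ P

/-- The Sobolev space `H¹₀(Ω)`, given as the set of pairs `(u, ∇u)`: the closure of the pairs
`(φ, ∇φ)`, `φ ∈ C_c^∞(Ω)`, in `L² × L²`, that is, the closure of `C_c^∞(Ω)` in the `H¹` norm. -/
def H10Graph (Ω : Opens Plane) : Submodule ℂ (L2 Ω × L2Vec Ω) :=
  (LinearMap.range (testPair Ω)).topologicalClosure

/-- The space `H¹₀(Ω)` with its gradient, as an operator from `L²(Ω; ℂ)` to `L²(Ω; ℂ²)` with domain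
`H¹₀(Ω)`. -/
def grad (Ω : Opens Plane) : L2 Ω →ₗ.[ℂ] L2Vec Ω := (H10Graph Ω).toLinearPMap

/-- The Sobolev space `H¹₀(Ω)` as a subspace of `L²(Ω; ℂ)`. -/
def H10 (Ω : Opens Plane) : Submodule ℂ (L2 Ω) := (grad Ω).domain

/-- A square integrable function that is orthogonal to all test functions vanishes. -/
lemma eq_zero_of_forall_integral (f : Plane → ℂ)
    (hf : MemLp f 2 ((volume : Measure Plane).restrict (Ω : Set Plane)))
    (h : ∀ φ : 𝓓(Ω, ℂ), ∫ P in (Ω : Set Plane), f P * φ P = 0) :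
    f =ᵐ[(volume : Measure Plane).restrict (Ω : Set Plane)] 0 := by
  have hloc : LocallyIntegrableOn f (Ω : Set Plane) volume := by
    refine (locallyIntegrableOn_iff Ω.isOpen.isLocallyClosed).2 fun K hK hKc => ?_
    have h2 : MemLp f 2 ((volume : Measure Plane).restrict K) :=
      hf.mono_measure (Measure.restrict_mono hK le_rfl)
    have : IsFiniteMeasure ((volume : Measure Plane).restrict K) :=
      isFiniteMeasure_restrict.2 hKc.measure_lt_top.ne
    exact h2.integrable (by norm_num)
  have key := Ω.isOpen.ae_eq_zero_of_integral_contDiff_smul_eq_zero hloc ?_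
  · rw [Filter.EventuallyEq, ae_restrict_iff' Ω.isOpen.measurableSet]
    exact key
  · intro g hg hgc hgs
    have hsub : tsupport (fun P => (g P : ℂ)) ⊆ tsupport g :=
      closure_mono fun P hP => by
        simpa using hP
    let φ : 𝓓(Ω, ℂ) := ⟨fun P => (g P : ℂ), Complex.ofRealCLM.contDiff.comp hg,
      hgc.of_isClosed_subset (isClosed_tsupport _) hsub, hsub.trans hgs⟩
    have h1 := h φ
    rw [← setIntegral_eq_integral_of_forall_compl_eq_zero (s := (Ω : Set Plane))]
    · rw [← h1]
      refine integral_congr_ae (Filter.Eventually.of_forall fun P => ?_)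
      change g P • f P = f P * (g P : ℂ)
      rw [Complex.real_smul, mul_comm]
    · intro P hP
      rw [image_eq_zero_of_notMem_tsupport (fun h => hP (hgs h)), zero_smul]

lemma eq_zero_of_forall_inner_testFunction (f : L2 Ω)
    (h : ∀ φ : 𝓓(Ω, ℂ), ⟪(testPair Ω φ).1, f⟫_ℂ = 0) : f = 0 := by
  refine (Lp.eq_zero_iff_ae_eq_zero).2 (eq_zero_of_forall_integral f (Lp.memLp f) fun φ => ?_)
  let φ' : 𝓓(Ω, ℂ) := ⟨fun P => conj (φ P), Complex.conjCLE.contDiff.comp φ.contDiff,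
    φ.hasCompactSupport.comp_left (g := fun z => conj z) (by simp),
    (closure_mono fun P hP => by
      intro h0
      apply hP
      simp [h0]).trans φ.tsupport_subset⟩
  rw [← h φ', L2.inner_def]
  refine integral_congr_ae ?_
  filter_upwards [(memLp_testFunction φ').coeFn_toLp] with P hP
  change _ = ⟪((memLp_testFunction φ').toLp φ') P, f P⟫_ℂ
  rw [hP, RCLike.inner_apply]
  change _ = f P * conj (conj (φ P))
  rw [Complex.conj_conj]

/-- The bilinear pairing of `L²(Ω; ℂ)` with a square integrable function. -/
lemma integral_mul_eq_inner (u : L2 Ω) {w : Plane → ℂ}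
    (hw : MemLp w 2 ((volume : Measure Plane).restrict (Ω : Set Plane))) :
    ∫ P in (Ω : Set Plane), u P * w P = ⟪hw.star.toLp (star w), u⟫_ℂ := by
  rw [L2.inner_def]
  refine integral_congr_ae ?_
  filter_upwards [hw.star.coeFn_toLp] with P hP
  rw [hP, RCLike.inner_apply]
  simp

/-- The `i`-th component of a vector field. -/
def component (Ω : Opens Plane) (i : Fin 2) : L2Vec Ω →L[ℂ] L2 Ω :=
  (EuclideanSpace.proj i : EuclideanSpace ℂ (Fin 2) →L[ℂ] ℂ).compLpL 2 _

lemma coeFn_component (i : Fin 2) (g : L2Vec Ω) :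
    component Ω i g =ᵐ[(volume : Measure Plane).restrict (Ω : Set Plane)] fun P => g P i :=
  ContinuousLinearMap.coeFn_compLpL _ g

lemma integral_component_mul (i : Fin 2) (g : L2Vec Ω) (w : Plane → ℂ) :
    ∫ P in (Ω : Set Plane), g P i * w P = ∫ P in (Ω : Set Plane), component Ω i g P * w P := by
  refine integral_congr_ae ?_
  filter_upwards [coeFn_component i g] with P hP
  rw [hP]

lemma memLp_fderiv_axis (φ : 𝓓(Ω, ℂ)) (i : Fin 2) :
    MemLp (fun P => fderiv ℝ φ P (axis i)) 2
      ((volume : Measure Plane).restrict (Ω : Set Plane)) :=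
  ((continuous_fderiv_axis φ i).memLp_of_hasCompactSupport
    (hasCompactSupport_fderiv_axis φ i)).restrict _

lemma isWeakGrad_iff (p : L2 Ω × L2Vec Ω) : IsWeakGrad p.1 p.2 ↔
    ∀ (φ : 𝓓(Ω, ℂ)) (i : Fin 2),
      ⟪(memLp_fderiv_axis φ i).star.toLp _, p.1⟫_ℂ
        = -⟪(memLp_testFunction φ).star.toLp _, component Ω i p.2⟫_ℂ := by
  refine forall_congr' fun φ => forall_congr' fun i => ?_
  rw [integral_mul_eq_inner p.1 (memLp_fderiv_axis φ i), integral_component_mul,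
    integral_mul_eq_inner _ (memLp_testFunction φ)]

lemma isWeakGrad_testPair (φ : 𝓓(Ω, ℂ)) : IsWeakGrad (testPair Ω φ).1 (testPair Ω φ).2 := by
  intro ψ i
  have e1 : ∫ P in (Ω : Set Plane), (testPair Ω φ).1 P * fderiv ℝ ψ P (axis i)
      = ∫ P, φ P * fderiv ℝ ψ P (axis i) := by
    rw [← setIntegral_eq_integral_of_forall_compl_eq_zero (s := (Ω : Set Plane))
      (f := fun P => φ P * fderiv ℝ ψ P (axis i))]
    · refine integral_congr_ae ?_
      filter_upwards [(memLp_testFunction φ).coeFn_toLp] with P hP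
      change ((memLp_testFunction φ).toLp φ) P * _ = _
      rw [hP]
    · intro P hP
      rw [image_eq_zero_of_notMem_tsupport (fun h => hP (φ.tsupport_subset h)), zero_mul]
  have e2 : ∫ P in (Ω : Set Plane), (testPair Ω φ).2 P i * ψ P
      = ∫ P, fderiv ℝ φ P (axis i) * ψ P := by
    rw [← setIntegral_eq_integral_of_forall_compl_eq_zero (s := (Ω : Set Plane))
      (f := fun P => fderiv ℝ φ P (axis i) * ψ P)]
    · refine integral_congr_ae ?_
      filter_upwards [(memLp_classicalGrad φ).coeFn_toLp] with P hP
      change ((memLp_classicalGrad φ).toLp _) P i * _ = _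
      rw [hP]
      rfl
    · intro P hP
      rw [image_eq_zero_of_notMem_tsupport (fun h => hP (ψ.tsupport_subset h)), mul_zero]
  rw [e1, e2]
  have dφ : Differentiable ℝ φ := φ.contDiff.differentiable (by simp)
  have dψ : Differentiable ℝ ψ := ψ.contDiff.differentiable (by simp)
  refine integral_mul_fderiv_eq_neg_fderiv_mul_of_integrable ?_ ?_ ?_
    (fun P _ => dφ P) (fun P _ => dψ P)
  · exact ((continuous_fderiv_axis φ i).mul ψ.continuous).integrable_of_hasCompactSupport
      ψ.hasCompactSupport.mul_left
  · exact (φ.continuous.mul (continuous_fderiv_axis ψ i)).integrable_of_hasCompactSupport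
      φ.hasCompactSupport.mul_right
  · exact (φ.continuous.mul ψ.continuous).integrable_of_hasCompactSupport
      φ.hasCompactSupport.mul_right

/-- The gradient on `H¹₀(Ω)` is the weak gradient. -/
lemma isWeakGrad_of_mem_H10Graph {p : L2 Ω × L2Vec Ω} (hp : p ∈ H10Graph Ω) :
    IsWeakGrad p.1 p.2 := by
  have hclosed : IsClosed {p : L2 Ω × L2Vec Ω | IsWeakGrad p.1 p.2} := by
    simp only [isWeakGrad_iff, Set.ofPred_forall]
    refine isClosed_iInter fun φ => isClosed_iInter fun i => isClosed_eq ?_ ?_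
    · exact continuous_const.inner continuous_fst
    · exact (continuous_const.inner ((component Ω i).continuous.comp continuous_snd)).neg
  have hp' : p ∈ closure (LinearMap.range (testPair Ω) : Set (L2 Ω × L2Vec Ω)) := hp
  refine closure_minimal ?_ hclosed hp'
  rintro _ ⟨φ, rfl⟩
  exact isWeakGrad_testPair φ

/-- The weak gradient is unique. -/
lemma IsWeakGrad.unique {u : L2 Ω} {g g' : L2Vec Ω} (h : IsWeakGrad u g) (h' : IsWeakGrad u g') :
    g = g' := by
  have hc : ∀ i, component Ω i (g - g') = 0 := by
    intro i
    refine (Lp.eq_zero_iff_ae_eq_zero).2 (eq_zero_of_forall_integral _ (Lp.memLp _) fun φ => ?_)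
    have h1 := (isWeakGrad_iff (u, g)).1 h φ i
    have h2 := (isWeakGrad_iff (u, g')).1 h' φ i
    rw [integral_mul_eq_inner _ (memLp_testFunction φ), map_sub, inner_sub_right, sub_eq_zero]
    exact neg_injective (h1.symm.trans h2)
  rw [← sub_eq_zero]
  refine (Lp.eq_zero_iff_ae_eq_zero).2 ?_
  filter_upwards [coeFn_component 0 (g - g'), coeFn_component 1 (g - g'),
    (Lp.eq_zero_iff_ae_eq_zero).1 (hc 0), (Lp.eq_zero_iff_ae_eq_zero).1 (hc 1)] with P h0 h1 k0 k1
  ext i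
  fin_cases i
  · exact h0.symm.trans k0
  · exact h1.symm.trans k1

lemma H10Graph_single_valued (p : L2 Ω × L2Vec Ω) (hp : p ∈ H10Graph Ω) (h0 : p.1 = 0) :
    p.2 = 0 := by
  have h1 : IsWeakGrad p.1 p.2 := isWeakGrad_of_mem_H10Graph hp
  have h2 : IsWeakGrad (0 : L2 Ω) (0 : L2Vec Ω) :=
    isWeakGrad_of_mem_H10Graph (p := 0) (Submodule.zero_mem _)
  rw [h0] at h1
  exact h1.unique h2

lemma grad_graph (Ω : Opens Plane) : (grad Ω).graph = H10Graph Ω :=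
  Submodule.toLinearPMap_graph_eq _ H10Graph_single_valued

/-- The sesquilinear form of the Stark Hamiltonian on `H¹₀(Ω)`,
`Q_h(v, u) = h² ∫_Ω ⟨∇v, ∇u⟩ + ∫_Ω x v̄ u`, conjugate linear in `v`. -/
def starkForm (Ω : Opens Plane) (h : ℝ) (v u : H10 Ω) : ℂ :=
  (h : ℂ) ^ 2 * ⟪grad Ω v, grad Ω u⟫_ℂ
    + ∫ P in (Ω : Set Plane), ((P 0 : ℝ) : ℂ) * ⟪(v : L2 Ω) P, (u : L2 Ω) P⟫_ℂ

lemma integrable_potential (hΩ : Bornology.IsBounded (Ω : Set Plane)) (v u : L2 Ω) :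
    Integrable (fun P : Plane => ((P 0 : ℝ) : ℂ) * ⟪v P, u P⟫_ℂ)
      ((volume : Measure Plane).restrict (Ω : Set Plane)) := by
  obtain ⟨R, hR⟩ := hΩ.exists_norm_le
  refine (L2.integrable_inner (𝕜 := ℂ) v u).bdd_mul (c := R) ?_ ?_
  · exact Continuous.aestronglyMeasurable (by fun_prop)
  · refine (ae_restrict_iff' Ω.isOpen.measurableSet).2 (Filter.Eventually.of_forall fun P hP => ?_)
    rw [Complex.norm_real]
    exact (PiLp.norm_apply_le P 0).trans (hR P hP)

lemma starkForm_add (hΩ : Bornology.IsBounded (Ω : Set Plane)) (h : ℝ) (v u u' : H10 Ω) :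
    starkForm Ω h v (u + u') = starkForm Ω h v u + starkForm Ω h v u' := by
  have e : ∫ P in (Ω : Set Plane), ((P 0 : ℝ) : ℂ) * ⟪(v : L2 Ω) P, ((u + u' : H10 Ω) : L2 Ω) P⟫_ℂ
      = (∫ P in (Ω : Set Plane), ((P 0 : ℝ) : ℂ) * ⟪(v : L2 Ω) P, (u : L2 Ω) P⟫_ℂ)
        + ∫ P in (Ω : Set Plane), ((P 0 : ℝ) : ℂ) * ⟪(v : L2 Ω) P, (u' : L2 Ω) P⟫_ℂ := by
    rw [← integral_add (integrable_potential hΩ _ _) (integrable_potential hΩ _ _)]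
    refine integral_congr_ae ?_
    filter_upwards [Lp.coeFn_add (u : L2 Ω) (u' : L2 Ω)] with P hP
    rw [Submodule.coe_add, hP, Pi.add_apply, inner_add_right, mul_add]
  have e' : grad Ω (u + u') = grad Ω u + grad Ω u' := (grad Ω).map_add u u'
  rw [starkForm, starkForm, starkForm, e, e', inner_add_right]
  ring

lemma starkForm_smul (h : ℝ) (v u : H10 Ω) (c : ℂ) :
    starkForm Ω h v (c • u) = c * starkForm Ω h v u := by
  have e : ∫ P in (Ω : Set Plane), ((P 0 : ℝ) : ℂ) * ⟪(v : L2 Ω) P, ((c • u : H10 Ω) : L2 Ω) P⟫_ℂ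
      = c * ∫ P in (Ω : Set Plane), ((P 0 : ℝ) : ℂ) * ⟪(v : L2 Ω) P, (u : L2 Ω) P⟫_ℂ := by
    rw [← integral_const_mul]
    refine integral_congr_ae ?_
    filter_upwards [Lp.coeFn_smul c (u : L2 Ω)] with P hP
    rw [Submodule.coe_smul, hP, Pi.smul_apply, inner_smul_right]
    ring
  have e' : grad Ω (c • u) = c • grad Ω u := (grad Ω).map_smul c u
  rw [starkForm, starkForm, e, e', inner_smul_right]
  ring

/-- The graph of the operator associated with the form `Q_h` on `H¹₀(Ω)` by the representation
theorem: `(u, f)` belongs to it iff `u ∈ H¹₀(Ω)`, `f ∈ L²(Ω)` and `Q_h(v, u) = ⟨v, f⟩` for all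
`v ∈ H¹₀(Ω)`. -/
def starkGraph (Ω : Opens Plane) (hΩ : Bornology.IsBounded (Ω : Set Plane)) (h : ℝ) :
    Submodule ℂ (L2 Ω × L2 Ω) where
  carrier := {p | ∃ u : H10 Ω, (u : L2 Ω) = p.1 ∧
    ∀ v : H10 Ω, starkForm Ω h v u = ⟪(v : L2 Ω), p.2⟫_ℂ}
  add_mem' := by
    rintro p p' ⟨u, hu, hf⟩ ⟨u', hu', hf'⟩
    refine ⟨u + u', by rw [Submodule.coe_add, hu, hu', Prod.fst_add], fun v => ?_⟩
    rw [starkForm_add hΩ, hf, hf', Prod.snd_add, inner_add_right]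
  zero_mem' := by
    refine ⟨0, rfl, fun v => ?_⟩
    have := starkForm_smul h v 0 0
    rw [zero_smul, zero_mul] at this
    rw [this, Prod.snd_zero, inner_zero_right]
  smul_mem' := by
    rintro c p ⟨u, hu, hf⟩
    refine ⟨c • u, by rw [Submodule.coe_smul, hu, Prod.smul_fst], fun v => ?_⟩
    rw [starkForm_smul, hf, Prod.smul_snd, inner_smul_right]

/-- The Dirichlet realization `𝓛_h = -h²Δ + x` of the Stark Hamiltonian on a bounded open set `Ω`:
the self-adjoint operator on `L²(Ω; ℂ)` associated with the form `Q_h` with form domain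
`H¹₀(Ω)`. -/
def starkOperator (Ω : Opens Plane) (hΩ : Bornology.IsBounded (Ω : Set Plane)) (h : ℝ) :
    L2 Ω →ₗ.[ℂ] L2 Ω :=
  (starkGraph Ω hΩ h).toLinearPMap

lemma testFunction_mem_H10 (φ : 𝓓(Ω, ℂ)) : (testPair Ω φ).1 ∈ H10 Ω :=
  ⟨testPair Ω φ, Submodule.le_topologicalClosure _ ⟨φ, rfl⟩, rfl⟩

lemma starkGraph_single_valued (hΩ : Bornology.IsBounded (Ω : Set Plane)) (h : ℝ)
    (p : L2 Ω × L2 Ω) (hp : p ∈ starkGraph Ω hΩ h) (h0 : p.1 = 0) : p.2 = 0 := by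
  obtain ⟨u, hu, hf⟩ := hp
  have hu0 : u = 0 := Subtype.ext (hu.trans h0)
  refine eq_zero_of_forall_inner_testFunction _ fun φ => ?_
  have h1 := hf ⟨(testPair Ω φ).1, testFunction_mem_H10 φ⟩
  have h2 := starkForm_smul h ⟨(testPair Ω φ).1, testFunction_mem_H10 φ⟩ 0 0
  rw [zero_smul, zero_mul] at h2
  rw [← h1, hu0, h2]

lemma starkOperator_graph (hΩ : Bornology.IsBounded (Ω : Set Plane)) (h : ℝ) :
    (starkOperator Ω hΩ h).graph = starkGraph Ω hΩ h :=
  Submodule.toLinearPMap_graph_eq _ (starkGraph_single_valued hΩ h)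

/-- `ψ` is an eigenfunction of the (unbounded) operator `T` with eigenvalue `lam`. -/
def IsEigenfunction (T : L2 Ω →ₗ.[ℂ] L2 Ω) (lam : ℝ) (ψ : L2 Ω) : Prop :=
  ψ ≠ 0 ∧ ∃ hψ : ψ ∈ T.domain, T ⟨ψ, hψ⟩ = (lam : ℂ) • ψ

/-- The infimum of the first coordinate over `Ω`. -/
def xMin (Ω : Opens Plane) : ℝ := sInf ((fun P : Plane => P 0) '' (Ω : Set Plane))

end Stark

end

namespace Stark

/-! This is an Agmon estimate with the linear phase `a * x`, `a = κ / h`. The eigenvalue equation is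
tested against `v = w u`, where `w = exp (2 a x)`. Since `|∇w| = 2 |a| w`, Young's inequality
absorbs the cross term into half of the gradient term at the price of `2 a² h² = 2 κ²` in the
potential; this is `integral_weight_mul_energy_nonpos`.

By compactness and uniqueness of the leftmost boundary point, `x ≥ xMin + δ` on `Ω` outside the disc
(`exists_pos_xMin_add_le`). For `h` small and `κ` fixed small, the effective potential `x - lam - 2
κ²` is at least `3δ/4` there, and it is negative only where `x < xMin + δ/2`. The weight is larger
on the first region than on the second by a factor `exp (κδ/h)` at least, so comparing the two
contributions yields exponential decay of function and gradient (`setIntegral_energy_le`). The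
factor `h²` in front of the gradient costs half of the exponential rate. -/

/-! ### Multiplication of `H¹₀(Ω)` by smooth functions. -/

lemma memLp_top_of_continuous {Ω : Opens Plane} {E : Type*} [NormedAddCommGroup E]
    (hΩ : Bornology.IsBounded (Ω : Set Plane)) {f : Plane → E} (hf : Continuous f) :
    MemLp f ∞ ((volume : Measure Plane).restrict (Ω : Set Plane)) := by
  obtain ⟨C, hC⟩ := hΩ.isCompact_closure.exists_bound_of_continuousOn hf.continuousOn
  refine memLp_top_of_bound hf.aestronglyMeasurable C ?_
  exact (ae_restrict_iff' Ω.isOpen.measurableSet).2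
    (Filter.Eventually.of_forall fun P hP => hC P (subset_closure hP))

lemma continuous_classicalGrad {w : Plane → ℂ} (hw : ContDiff ℝ ∞ w) :
    Continuous (classicalGrad w) :=
  (PiLp.continuous_toLp 2 _).comp (continuous_pi fun _ =>
    (hw.continuous_fderiv (by simp)).clm_apply continuous_const)

/-- `H¹₀(Ω)` is stable under multiplication by smooth functions, with the Leibniz rule. -/
lemma exists_mem_H10Graph_mul {Ω : Opens Plane} (hΩ : Bornology.IsBounded (Ω : Set Plane))
    {w : Plane → ℂ} (hw : ContDiff ℝ ∞ w) {p : L2 Ω × L2Vec Ω} (hp : p ∈ H10Graph Ω) :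
    ∃ q ∈ H10Graph Ω,
      (q.1 =ᵐ[(volume : Measure Plane).restrict (Ω : Set Plane)] fun P => w P * p.1 P) ∧
      q.2 =ᵐ[(volume : Measure Plane).restrict (Ω : Set Plane)]
        fun P => w P • p.2 P + p.1 P • classicalGrad w P := by
  have mw := memLp_top_of_continuous hΩ hw.continuous
  have mg := memLp_top_of_continuous hΩ (continuous_classicalGrad hw)
  let μ := (volume : Measure Plane).restrict (Ω : Set Plane)
  let B₀ := ContinuousLinearMap.mul ℂ ℂ
  let B₁ : ℂ →L[ℂ] EuclideanSpace ℂ (Fin 2) →L[ℂ] EuclideanSpace ℂ (Fin 2) :=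
    ContinuousLinearMap.lsmul ℂ ℂ
  -- The Leibniz rule is bounded on `L² × L²` by Hölder (`L^∞ · L² ⊆ L²`), because `w` and `∇w` are
  -- bounded on `Ω`. It maps pairs `(φ, ∇φ)` to such pairs, hence preserves their closure.
  let T : L2 Ω × L2Vec Ω → L2 Ω × L2Vec Ω := fun p =>
    (B₀.holderL μ ∞ 2 2 (mw.toLp w) p.1,
      B₁.holderL μ ∞ 2 2 (mw.toLp w) p.2 + B₁.flip.holderL μ ∞ 2 2 (mg.toLp _) p.1)
  have hT : Continuous T := by
    refine Continuous.prodMk ?_ (Continuous.add ?_ ?_)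
    · exact (B₀.holderL μ ∞ 2 2 (mw.toLp w)).continuous.comp continuous_fst
    · exact (B₁.holderL μ ∞ 2 2 (mw.toLp w)).continuous.comp continuous_snd
    · exact (B₁.flip.holderL μ ∞ 2 2 (mg.toLp _)).continuous.comp continuous_fst
  have hT₁ : ∀ p, (T p).1 =ᵐ[μ] fun P => w P * p.1 P := by
    intro p
    filter_upwards [B₀.coeFn_holder (r := 2) (mw.toLp w) p.1, mw.coeFn_toLp] with P h₁ h₂
    change (B₀.holder 2 (mw.toLp w) p.1) P = _
    rw [h₁, h₂]
    rfl
  have hT₂ : ∀ p, (T p).2 =ᵐ[μ] fun P => w P • p.2 P + p.1 P • classicalGrad w P := by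
    intro p
    filter_upwards [B₁.coeFn_holder (r := 2) (mw.toLp w) p.2,
      B₁.flip.coeFn_holder (r := 2) (mg.toLp _) p.1, mw.coeFn_toLp, mg.coeFn_toLp,
      Lp.coeFn_add (B₁.holder 2 (mw.toLp w) p.2) (B₁.flip.holder 2 (mg.toLp _) p.1)]
      with P h₁ h₂ h₃ h₄ h₅
    change (B₁.holder 2 (mw.toLp w) p.2 + B₁.flip.holder 2 (mg.toLp _) p.1 : L2Vec Ω) P = _
    rw [h₅, Pi.add_apply, h₁, h₂, h₃, h₄]
    rfl
  refine ⟨T p, ?_, hT₁ p, hT₂ p⟩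
  refine map_mem_closure hT (s := (LinearMap.range (testPair Ω) : Set (L2 Ω × L2Vec Ω))) hp ?_
  rintro _ ⟨φ, rfl⟩
  let φ' : 𝓓(Ω, ℂ) := ⟨fun P => w P * φ P, hw.mul φ.contDiff, φ.hasCompactSupport.mul_left,
    (closure_mono fun P hP => by
      intro h0
      apply hP
      simp [h0]).trans φ.tsupport_subset⟩
  refine ⟨φ', Prod.ext (Lp.ext ?_) (Lp.ext ?_)⟩
  · filter_upwards [hT₁ (testPair Ω φ), (memLp_testFunction φ').coeFn_toLp,
      (memLp_testFunction φ).coeFn_toLp] with P h₁ h₂ h₃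
    rw [h₁]
    refine h₂.trans ?_
    change _ = w P * ((memLp_testFunction φ).toLp φ) P
    rw [h₃]
    rfl
  · filter_upwards [hT₂ (testPair Ω φ), (memLp_classicalGrad φ').coeFn_toLp,
      (memLp_testFunction φ).coeFn_toLp, (memLp_classicalGrad φ).coeFn_toLp] with P h₁ h₂ h₃ h₄
    rw [h₁]
    refine h₂.trans ?_
    change _ = w P • ((memLp_classicalGrad φ).toLp _) P
      + ((memLp_testFunction φ).toLp φ) P • classicalGrad w P
    rw [h₃, h₄]
    have d₁ : DifferentiableAt ℝ w P := hw.differentiable (by simp) P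
    have d₂ : DifferentiableAt ℝ φ P := φ.contDiff.differentiable (by simp) P
    ext i
    change fderiv ℝ (fun P => w P * φ P) P (axis i) = _
    rw [fderiv_fun_mul d₁ d₂]
    simp [classicalGrad]

/-! ### The exponential weight and integrability. -/

/-- The exponential weight `exp (2 a x)`. -/
noncomputable def weight (a : ℝ) (P : Plane) : ℝ := Real.exp (2 * a * P 0)

lemma contDiff_weight (a : ℝ) : ContDiff ℝ ∞ (fun P : Plane => (weight a P : ℂ)) := by
  have h : ContDiff ℝ ∞ (weight a) := by
    unfold weight
    fun_prop
  exact Complex.ofRealCLM.contDiff.comp h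

/-- The gradient is pointwise proportional to the weight itself, which is what lets the cross term
be absorbed under the same weight. -/
lemma norm_classicalGrad_weight (a : ℝ) (P : Plane) :
    ‖classicalGrad (fun P => (weight a P : ℂ)) P‖ = 2 * |a| * weight a P := by
  have hl : HasFDerivAt (fun P : Plane => 2 * a * P 0)
      ((2 * a) • (EuclideanSpace.proj 0 : Plane →L[ℝ] ℝ)) P :=
    (EuclideanSpace.proj (0 : Fin 2) : Plane →L[ℝ] ℝ).hasFDerivAt.const_mul (2 * a)
  have hd := Complex.ofRealCLM.hasFDerivAt.comp P hl.exp
  have e : classicalGrad (fun P => (weight a P : ℂ)) P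
      = EuclideanSpace.single 0 ((weight a P * (2 * a) : ℝ) : ℂ) := by
    ext i
    change fderiv ℝ (fun P : Plane => (weight a P : ℂ)) P (axis i) = _
    rw [show fderiv ℝ (fun P : Plane => (weight a P : ℂ)) P = _ from hd.fderiv]
    fin_cases i <;> simp [axis, weight]
  rw [e, PiLp.norm_single, Complex.norm_real, Real.norm_eq_abs, abs_mul, abs_mul,
    abs_of_pos (show 0 < weight a P from Real.exp_pos _), abs_two]
  ring

lemma integrable_mul_norm_sq {Ω : Opens Plane} (hΩ : Bornology.IsBounded (Ω : Set Plane))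
    {E : Type*} [NormedAddCommGroup E] {c : Plane → ℝ} (hc : Continuous c)
    (f : Lp E 2 ((volume : Measure Plane).restrict (Ω : Set Plane))) :
    Integrable (fun P => c P * ‖f P‖ ^ 2)
      ((volume : Measure Plane).restrict (Ω : Set Plane)) :=
  (memLp_one_iff_integrable.2 (Lp.memLp f).norm.integrable_sq).mul
    (memLp_top_of_continuous hΩ hc) |> memLp_one_iff_integrable.1 |>.congr
    (Filter.Eventually.of_forall fun P => by simp)

lemma integral_norm_sq {Ω : Opens Plane} (u : L2 Ω) :
    ∫ P in (Ω : Set Plane), ‖u P‖ ^ 2 = ‖u‖ ^ 2 := by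
  have h : ⟪u, u⟫_ℂ = ((∫ P in (Ω : Set Plane), ‖u P‖ ^ 2 : ℝ) : ℂ) := by
    rw [L2.inner_def]
    refine Eq.trans ?_ (integral_ofReal (𝕜 := ℂ))
    refine integral_congr_ae (Filter.Eventually.of_forall fun P => ?_)
    exact inner_self_eq_norm_sq_to_K (𝕜 := ℂ) (u P) |>.trans (Complex.ofReal_pow _ _).symm
  rw [inner_self_eq_norm_sq_to_K] at h
  exact Complex.ofReal_injective (h.symm.trans (Complex.ofReal_pow _ _).symm)

/-! ### The weighted energy inequality. -/

/-- Passing to the weak form places `ψ` in the form domain and allows any `H¹₀` test function. -/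
lemma exists_form_eq_of_isEigenfunction {Ω : Opens Plane}
    {hΩ : Bornology.IsBounded (Ω : Set Plane)} {h lam : ℝ} {ψ : L2 Ω}
    (hψ : IsEigenfunction (starkOperator Ω hΩ h) lam ψ) :
    ∃ hm : ψ ∈ H10 Ω, ∀ v : H10 Ω, starkForm Ω h v ⟨ψ, hm⟩ = lam * ⟪(v : L2 Ω), ψ⟫_ℂ := by
  obtain ⟨-, hd, he⟩ := hψ
  have hg := (starkOperator Ω hΩ h).mem_graph ⟨ψ, hd⟩
  rw [he, starkOperator_graph] at hg
  obtain ⟨u, hu, hf⟩ := hg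
  have hu' : (u : L2 Ω) = ψ := hu
  subst hu'
  refine ⟨u.2, fun v => ?_⟩
  rw [← inner_smul_right]
  exact hf v

/-- The weighted energy inequality. -/
lemma integral_weight_mul_energy_nonpos {Ω : Opens Plane}
    (hΩ : Bornology.IsBounded (Ω : Set Plane)) {h lam : ℝ} (a : ℝ) {u : H10 Ω}
    (hu : ∀ v : H10 Ω, starkForm Ω h v u = lam * ⟪(v : L2 Ω), (u : L2 Ω)⟫_ℂ) :
    ∫ P in (Ω : Set Plane), (weight a P * (h ^ 2 / 2) * ‖grad Ω u P‖ ^ 2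
      + weight a P * (P 0 - lam - 2 * a ^ 2 * h ^ 2) * ‖(u : L2 Ω) P‖ ^ 2) ≤ 0 := by
  have hcw : Continuous (weight a) := by unfold weight; fun_prop
  have hp : ((u : L2 Ω), grad Ω u) ∈ H10Graph Ω := by
    rw [← grad_graph]
    exact (grad Ω).mem_graph u
  -- The test function is `v = exp (2 a x) u`, with `∇v = w ∇u + u ∇w`.
  obtain ⟨q, hq, hq₁, hq₂⟩ := exists_mem_H10Graph_mul hΩ (contDiff_weight a) hp
  rw [← grad_graph, LinearPMap.mem_graph_iff] at hq
  obtain ⟨v, hv₁, hv₂⟩ := hq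
  rw [← hv₁] at hq₁
  rw [← hv₂] at hq₂
  let μ := (volume : Measure Plane).restrict (Ω : Set Plane)
  let F : Plane → ℂ := fun P => (h : ℂ) ^ 2 * ⟪grad Ω v P, grad Ω u P⟫_ℂ
    + ((P 0 : ℝ) : ℂ) * ⟪(v : L2 Ω) P, (u : L2 Ω) P⟫_ℂ - lam * ⟪(v : L2 Ω) P, (u : L2 Ω) P⟫_ℂ
  have i₁ : Integrable (fun P => (h : ℂ) ^ 2 * ⟪grad Ω v P, grad Ω u P⟫_ℂ) μ :=
    (L2.integrable_inner (𝕜 := ℂ) (grad Ω v) (grad Ω u)).const_mul _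
  have i₂ := integrable_potential hΩ (v : L2 Ω) (u : L2 Ω)
  have i₃ : Integrable (fun P => (lam : ℂ) * ⟪(v : L2 Ω) P, (u : L2 Ω) P⟫_ℂ) μ :=
    (L2.integrable_inner (𝕜 := ℂ) (v : L2 Ω) (u : L2 Ω)).const_mul _
  have iF : Integrable F μ := (i₁.add i₂).sub i₃
  have hF : ∫ P, F P ∂μ = 0 := by
    have h₁ : (h : ℂ) ^ 2 * ⟪grad Ω v, grad Ω u⟫_ℂ
        + ∫ P in (Ω : Set Plane), ((P 0 : ℝ) : ℂ) * ⟪(v : L2 Ω) P, (u : L2 Ω) P⟫_ℂ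
        = lam * ⟪(v : L2 Ω), (u : L2 Ω)⟫_ℂ := hu v
    rw [L2.inner_def, L2.inner_def, ← integral_const_mul, ← integral_const_mul] at h₁
    refine (integral_sub (i₁.add i₂) i₃).trans (sub_eq_zero.2 ?_)
    exact (integral_add i₁ i₂).trans h₁
  -- Only the cross term `⟪u ∇w, ∇u⟫` can fail to be real; taking real parts reduces the claim to a
  -- pointwise inequality of integrands.
  have hFre : ∫ P, RCLike.re (F P) ∂μ = 0 := by
    rw [integral_re iF, hF, map_zero]
  rw [← hFre]
  refine integral_mono_ae ((integrable_mul_norm_sq hΩ (by fun_prop) _).add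
    (integrable_mul_norm_sq hΩ (by fun_prop) _)) iF.re ?_
  filter_upwards [hq₁, hq₂] with P h₁ h₂
  change _ ≤ RCLike.re ((h : ℂ) ^ 2 * ⟪grad Ω v P, grad Ω u P⟫_ℂ
    + ((P 0 : ℝ) : ℂ) * ⟪(v : L2 Ω) P, (u : L2 Ω) P⟫_ℂ - lam * ⟪(v : L2 Ω) P, (u : L2 Ω) P⟫_ℂ)
  rw [h₁, h₂, inner_add_left]
  dsimp only
  set G := grad Ω u P
  set U := (u : L2 Ω) P
  set D := classicalGrad (fun P => (weight a P : ℂ)) P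
  have hw : 0 < weight a P := Real.exp_pos _
  have e₁ : ⟪(weight a P : ℂ) • G, G⟫_ℂ = ((weight a P * ‖G‖ ^ 2 : ℝ) : ℂ) := by
    rw [inner_smul_left, Complex.conj_ofReal, inner_self_eq_norm_sq_to_K]
    simp
  have e₂ : ⟪(weight a P : ℂ) * U, U⟫_ℂ = ((weight a P * ‖U‖ ^ 2 : ℝ) : ℂ) := by
    rw [← smul_eq_mul, inner_smul_left, Complex.conj_ofReal, inner_self_eq_norm_sq_to_K]
    simp
  have e₃ : -(‖U‖ * (2 * |a| * weight a P) * ‖G‖) ≤ (⟪U • D, G⟫_ℂ).re := by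
    have := (abs_le.1 ((Complex.abs_re_le_norm _).trans (norm_inner_le_norm (𝕜 := ℂ) (U • D) G))).1
    rwa [norm_smul, norm_classicalGrad_weight] at this
  have e₄ : RCLike.re ((h : ℂ) ^ 2 * (⟪(weight a P : ℂ) • G, G⟫_ℂ + ⟪U • D, G⟫_ℂ)
      + ((P 0 : ℝ) : ℂ) * ⟪(weight a P : ℂ) * U, U⟫_ℂ - lam * ⟪(weight a P : ℂ) * U, U⟫_ℂ)
      = h ^ 2 * (weight a P * ‖G‖ ^ 2 + (⟪U • D, G⟫_ℂ).re)
        + (P 0 - lam) * (weight a P * ‖U‖ ^ 2) := by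
    rw [e₁, e₂, ← Complex.ofReal_pow]
    simp only [RCLike.re_eq_complex_re, Complex.add_re, Complex.sub_re, Complex.re_ofReal_mul,
      Complex.ofReal_re]
    ring
  rw [e₄]
  -- Young's inequality: `2|a| ‖U‖ ‖G‖ ≤ ‖G‖²/2 + 2a² ‖U‖²`.
  have e₅ : 0 ≤ weight a P * (‖G‖ - 2 * |a| * ‖U‖) ^ 2 := by positivity
  have e₆ : weight a P * ‖G‖ ^ 2 / 2 - 2 * a ^ 2 * weight a P * ‖U‖ ^ 2
      ≤ weight a P * ‖G‖ ^ 2 + (⟪U • D, G⟫_ℂ).re := by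
    rw [← sq_abs a]
    linarith
  linarith [mul_le_mul_of_nonneg_left e₆ (sq_nonneg h)]

/-! ### The potential away from its minimum. -/

lemma xMin_le {Ω : Opens Plane} (hΩ : Bornology.IsBounded (Ω : Set Plane)) {P : Plane}
    (hP : P ∈ Ω) : xMin Ω ≤ P 0 := by
  obtain ⟨R, hR⟩ := hΩ.exists_norm_le
  refine csInf_le ⟨-R, ?_⟩ ⟨P, hP, rfl⟩
  rintro _ ⟨Q, hQ, rfl⟩
  exact (abs_le.1 ((PiLp.norm_apply_le Q 0).trans (hR Q hQ))).1

/-- The first coordinate does not attain its infimum on the open set `Ω`. -/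
lemma xMin_lt {Ω : Opens Plane} (hΩ : Bornology.IsBounded (Ω : Set Plane)) {P : Plane}
    (hP : P ∈ Ω) : xMin Ω < P 0 := by
  -- A small shift to the left stays in the open set and lowers the first coordinate.
  have hc : Continuous fun t : ℝ => P - t • axis 0 := by fun_prop
  have hev : ∀ᶠ t in nhdsWithin (0 : ℝ) (Set.Ioi 0), P - t • axis 0 ∈ Ω :=
    (hc.tendsto 0).mono_left nhdsWithin_le_nhds |>.eventually
      (Ω.isOpen.mem_nhds (by simpa using hP))
  obtain ⟨t, ht, ht0⟩ := (hev.and self_mem_nhdsWithin).exists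
  have := xMin_le hΩ ht
  simp only [PiLp.sub_apply, PiLp.smul_apply, axis, PiLp.single_apply, if_true,
    smul_eq_mul, mul_one] at this
  have ht1 : 0 < t := ht0
  linarith

/-- On the compact set `closure Ω` minus the disc, `x` attains its minimum. If this were `xMin Ω`,
the minimizer could not lie in `Ω`, so it would be a boundary point and equal `A₀`, which is in the
disc. -/
lemma exists_pos_xMin_add_le {Ω : Opens Plane} (hΩ : Bornology.IsBounded (Ω : Set Plane))
    {A₀ : Plane} (huniq : ∀ P ∈ frontier (Ω : Set Plane), P 0 = xMin Ω → P = A₀)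
    {η : ℝ} (hη : 0 < η) :
    ∃ δ > 0, ∀ P ∈ (Ω : Set Plane) ∩ (Metric.ball A₀ η)ᶜ, xMin Ω + δ ≤ P 0 := by
  have hK : IsCompact (closure (Ω : Set Plane) ∩ (Metric.ball A₀ η)ᶜ) :=
    hΩ.isCompact_closure.inter_right Metric.isOpen_ball.isClosed_compl
  have hcont : Continuous fun P : Plane => P 0 := by fun_prop
  have hle : ∀ P ∈ closure (Ω : Set Plane), xMin Ω ≤ P 0 := fun P hP =>
    closure_minimal (fun Q hQ => xMin_le hΩ hQ) (isClosed_le continuous_const hcont) hP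
  rcases (closure (Ω : Set Plane) ∩ (Metric.ball A₀ η)ᶜ).eq_empty_or_nonempty with he | hne
  · exact ⟨1, one_pos, fun P hP => absurd (he ▸ ⟨subset_closure hP.1, hP.2⟩ : P ∈ (∅ : Set Plane))
      (Set.notMem_empty P)⟩
  · obtain ⟨Q, hQ, hmin⟩ := hK.exists_isMinOn hne hcont.continuousOn
    refine ⟨Q 0 - xMin Ω, sub_pos.2 (lt_of_le_of_ne (hle Q hQ.1) fun h => ?_), fun P hP => ?_⟩
    · have hQΩ : Q ∉ (Ω : Set Plane) := fun hmem => (xMin_lt hΩ hmem).ne h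
      have hfr : Q ∈ frontier (Ω : Set Plane) :=
        ⟨hQ.1, fun hi => hQΩ (interior_subset hi)⟩
      apply hQ.2
      rw [huniq Q hfr h.symm]
      exact Metric.mem_ball_self hη
    · have : Q 0 ≤ P 0 := hmin ⟨subset_closure hP.1, hP.2⟩
      linarith

/-! ### Exponential decay from the energy inequality. -/

/-- The weighted estimate away from the minimum of the potential. -/
lemma setIntegral_energy_le {Ω : Opens Plane}
    (hΩ : Bornology.IsBounded (Ω : Set Plane)) {h lam δ κ : ℝ} (hh : 0 < h) (hδ : 0 < δ)
    (hκ : 0 < κ) (hκδ : 2 * κ ^ 2 = δ / 8) (hlam : lam ≤ xMin Ω + δ / 8)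
    {S : Set Plane} (hSm : MeasurableSet S) (hSΩ : S ⊆ Ω) (hS : ∀ P ∈ S, xMin Ω + δ ≤ P 0)
    {u : H10 Ω} (hu : ∀ v : H10 Ω, starkForm Ω h v u = lam * ⟪(v : L2 Ω), (u : L2 Ω)⟫_ℂ) :
    ∫ P in S, (h ^ 2 / 2 * ‖grad Ω u P‖ ^ 2 + 3 * δ / 4 * ‖(u : L2 Ω) P‖ ^ 2)
      ≤ δ / 4 * Real.exp (-(κ * δ) / h) * ‖(u : L2 Ω)‖ ^ 2 := by
  -- With this scaling the loss `2 a² h²` is the constant `δ/8`, while the phase is of order `1/h`.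
  set a := κ / h
  have hah : 2 * a ^ 2 * h ^ 2 = δ / 8 := by
    rw [← hκδ]
    simp only [a]
    field_simp
  have ha : 0 < a := div_pos hκ hh
  set x₀ := xMin Ω
  -- `m` bounds the weight below on `S`; `k` bounds it above where `x ≤ x₀ + δ/2`. The gap `δ/2`
  -- gives `k / m = exp (-κδ/h)`.
  set m := Real.exp (2 * a * (x₀ + δ))
  set k := Real.exp (2 * a * (x₀ + δ / 2))
  have hkm : k = m * Real.exp (-(κ * δ) / h) := by
    simp only [k, m, a]
    rw [← Real.exp_add]
    congr 1
    field_simp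
    ring
  have hcw : Continuous (weight a) := by unfold weight; fun_prop
  let μ := (volume : Measure Plane).restrict (Ω : Set Plane)
  let q : Plane → ℝ := fun P => weight a P * (h ^ 2 / 2) * ‖grad Ω u P‖ ^ 2
      + weight a P * (P 0 - lam - 2 * a ^ 2 * h ^ 2) * ‖(u : L2 Ω) P‖ ^ 2
  -- `r` compensates the negative part of `q`: where `x ≤ x₀ + δ/2`, the effective potential is at
  -- least `-δ/4` and the weight at most `k`; elsewhere `q ≥ 0` already.
  let r : Plane → ℝ := fun P => δ / 4 * k * ‖(u : L2 Ω) P‖ ^ 2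
  let e : Plane → ℝ := fun P => h ^ 2 / 2 * ‖grad Ω u P‖ ^ 2 + 3 * δ / 4 * ‖(u : L2 Ω) P‖ ^ 2
  have iq : Integrable q μ := (integrable_mul_norm_sq hΩ (by fun_prop) _).add
    (integrable_mul_norm_sq hΩ (by fun_prop) _)
  have ir : Integrable r μ := integrable_mul_norm_sq hΩ continuous_const _
  have ie : Integrable e μ := (integrable_mul_norm_sq hΩ continuous_const _).add
    (integrable_mul_norm_sq hΩ continuous_const _)
  have hnn : ∀ P ∈ (Ω : Set Plane), 0 ≤ q P + r P := by
    intro P hP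
    have hx : x₀ ≤ P 0 := xMin_le hΩ hP
    have hw : 0 < weight a P := Real.exp_pos _
    have h₁ : 0 ≤ weight a P * (P 0 - lam - 2 * a ^ 2 * h ^ 2) + δ / 4 * k := by
      rw [hah]
      rcases le_total (x₀ + δ / 2) (P 0) with hc | hc
      · have : 0 ≤ P 0 - lam - δ / 8 := by linarith
        positivity
      · have hwk : weight a P ≤ k := Real.exp_le_exp.2 (by gcongr)
        have : -(δ / 4) ≤ P 0 - lam - δ / 8 := by linarith
        nlinarith
    have h₂ : 0 ≤ weight a P * (h ^ 2 / 2) * ‖grad Ω u P‖ ^ 2 := by positivity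
    have h₃ := mul_nonneg h₁ (sq_nonneg ‖(u : L2 Ω) P‖)
    simp only [q, r]
    linarith
  have hge : ∀ P ∈ S, m * e P ≤ q P + r P := by
    intro P hP
    have hx := hS P hP
    have hmw : m ≤ weight a P := Real.exp_le_exp.2 (by gcongr)
    have hm : 0 < m := Real.exp_pos _
    have h₁ : m * (3 * δ / 4) ≤ weight a P * (P 0 - lam - 2 * a ^ 2 * h ^ 2) := by
      rw [hah]
      refine mul_le_mul hmw (by linarith) (by positivity) (hm.le.trans hmw)
    have h₂ := mul_le_mul_of_nonneg_right h₁ (sq_nonneg ‖(u : L2 Ω) P‖)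
    have h₃ := mul_le_mul_of_nonneg_right hmw
      (by positivity : 0 ≤ h ^ 2 / 2 * ‖grad Ω u P‖ ^ 2)
    have h₄ : 0 ≤ δ / 4 * k * ‖(u : L2 Ω) P‖ ^ 2 := by positivity
    simp only [q, r, e]
    linarith
  have hle : m * ∫ P in S, e P ≤ δ / 4 * k * ‖(u : L2 Ω)‖ ^ 2 := by
    calc m * ∫ P in S, e P = ∫ P in S, m * e P := (integral_const_mul _ _).symm
      _ ≤ ∫ P in S, (q P + r P) := setIntegral_mono_on
          ((IntegrableOn.mono_set ie hSΩ).const_mul m)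
          (IntegrableOn.mono_set (iq.add ir) hSΩ)
          hSm hge
      -- Enlarging `S` to `Ω` is permitted by `hnn`; the energy inequality then discards `q`.
      _ ≤ ∫ P in (Ω : Set Plane), (q P + r P) := setIntegral_mono_set (iq.add ir)
          ((ae_restrict_iff' Ω.isOpen.measurableSet).2 (Filter.Eventually.of_forall hnn))
          hSΩ.eventuallyLE
      _ = (∫ P in (Ω : Set Plane), q P) + ∫ P in (Ω : Set Plane), r P := integral_add iq ir
      _ ≤ 0 + ∫ P in (Ω : Set Plane), r P := by
          gcongr
          exact integral_weight_mul_energy_nonpos hΩ a hu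
      _ = δ / 4 * k * ‖(u : L2 Ω)‖ ^ 2 := by
          rw [zero_add, ← integral_norm_sq, ← integral_const_mul]
  have hm : 0 < m := Real.exp_pos _
  rw [hkm] at hle
  refine le_of_mul_le_mul_left (hle.trans_eq ?_) hm
  ring

/-- From `t²/2 ≤ exp t` at `t = s/h`; it pays for dividing the gradient bound by `h²`. -/
lemma inv_sq_le_exp {s h : ℝ} (hs : 0 < s) (hh : 0 < h) :
    1 / h ^ 2 ≤ 2 / s ^ 2 * Real.exp (s / h) := by
  have h₁ := Real.quadratic_le_exp_of_nonneg (div_pos hs hh).le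
  have h₂ : (s / h) ^ 2 / 2 ≤ Real.exp (s / h) := by linarith [div_pos hs hh]
  calc 1 / h ^ 2 = 2 / s ^ 2 * ((s / h) ^ 2 / 2) := by field_simp
    _ ≤ _ := by gcongr

end Stark

/-! ### The main theorem: choice of constants. -/

open Stark in
theorem mainTheorem4
    (Ω : TopologicalSpace.Opens Stark.Plane)
    (hΩ : Bornology.IsBounded (Ω : Set Stark.Plane))
    (hconn : IsConnected (Ω : Set Stark.Plane))
    (A₀ : Stark.Plane)
    (hA₀ : A₀ ∈ frontier (Ω : Set Stark.Plane))
    (hmin : A₀ 0 = Stark.xMin Ω)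
    (huniq : ∀ P ∈ frontier (Ω : Set Stark.Plane), P 0 = Stark.xMin Ω → P = A₀)
    (M η : ℝ) (hM : 0 < M) (hη : 0 < η) :
    ∃ c C h₀ : ℝ, 0 < c ∧ 0 < C ∧ 0 < h₀ ∧
      ∀ h : ℝ, 0 < h → h < h₀ →
      ∀ (lam : ℝ) (ψ : Stark.L2 Ω),
        Stark.IsEigenfunction (Stark.starkOperator Ω hΩ h) lam ψ →
        lam ≤ Stark.xMin Ω + M * h ^ (2 / 3 : ℝ) →
        (∫ P in (Ω : Set Stark.Plane) ∩ (Metric.ball A₀ η)ᶜ, ‖ψ P‖ ^ 2)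
            ≤ C * Real.exp (-c / h) * ‖ψ‖ ^ 2 ∧
        ∃ hψ : ψ ∈ Stark.H10 Ω,
          (∫ P in (Ω : Set Stark.Plane) ∩ (Metric.ball A₀ η)ᶜ, ‖Stark.grad Ω ⟨ψ, hψ⟩ P‖ ^ 2)
            ≤ C * Real.exp (-c / h) * ‖ψ‖ ^ 2 := by
  obtain ⟨δ, hδ, hfar⟩ := exists_pos_xMin_add_le hΩ huniq hη
  set κ := Real.sqrt (δ / 16)
  have hκ : 0 < κ := Real.sqrt_pos.2 (by positivity)
  have hκδ : 2 * κ ^ 2 = δ / 8 := by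
    rw [Real.sq_sqrt (by positivity)]
    ring
  -- Half of the available rate `κδ`: the other half absorbs `1/h²`.
  set s := κ * δ / 2
  have hs : 0 < s := by positivity
  -- `h₀` is where `M h^(2/3) = δ/8`. In `C`, the `1` serves the function and `δ / s²` the gradient.
  refine ⟨s, 1 + δ / s ^ 2, (δ / (8 * M)) ^ (3 / 2 : ℝ), hs, by positivity, by positivity, ?_⟩
  intro h hh hh₀ lam ψ hψ hlam
  have hlam' : lam ≤ xMin Ω + δ / 8 := by
    have h₁ : h ^ (2 / 3 : ℝ) ≤ δ / (8 * M) := by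
      calc h ^ (2 / 3 : ℝ) ≤ ((δ / (8 * M)) ^ (3 / 2 : ℝ)) ^ (2 / 3 : ℝ) := by gcongr
        _ = δ / (8 * M) := by
          rw [← Real.rpow_mul (by positivity)]
          norm_num
    have h₂ : M * (δ / (8 * M)) = δ / 8 := by field_simp
    linarith [mul_le_mul_of_nonneg_left h₁ hM.le]
  obtain ⟨hm, hform⟩ := exists_form_eq_of_isEigenfunction hψ
  set S := (Ω : Set Plane) ∩ (Metric.ball A₀ η)ᶜ
  have hSm : MeasurableSet S := Ω.isOpen.measurableSet.inter measurableSet_ball.compl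
  have hE := setIntegral_energy_le hΩ hh hδ hκ hκδ hlam' hSm Set.inter_subset_left hfar hform
  have ig := IntegrableOn.mono_set (Lp.memLp (grad Ω ⟨ψ, hm⟩)).norm.integrable_sq
    (Set.inter_subset_left : S ⊆ Ω)
  have iu := IntegrableOn.mono_set (Lp.memLp ψ).norm.integrable_sq
    (Set.inter_subset_left : S ⊆ Ω)
  have hsplit := integral_add (ig.const_mul (h ^ 2 / 2)) (iu.const_mul (3 * δ / 4))
  rw [integral_const_mul, integral_const_mul] at hsplit
  replace hE := hsplit.symm.trans_le hE
  have hexp : Real.exp (-(κ * δ) / h) = Real.exp (-s / h) * Real.exp (-s / h) := by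
    rw [← Real.exp_add]
    congr 1
    simp only [s]
    ring
  have hle1 : Real.exp (-s / h) ≤ 1 :=
    Real.exp_le_one_iff.2 (div_nonpos_of_nonpos_of_nonneg (by linarith) hh.le)
  set J := ∫ P in S, ‖ψ P‖ ^ 2
  set K := ∫ P in S, ‖grad Ω ⟨ψ, hm⟩ P‖ ^ 2
  have hJ : 0 ≤ J := integral_nonneg fun P => by positivity
  have hK : 0 ≤ K := integral_nonneg fun P => by positivity
  set E := Real.exp (-s / h)
  have hEpos : 0 < E := Real.exp_pos _
  rw [hexp] at hE
  change h ^ 2 / 2 * K + 3 * δ / 4 * J ≤ δ / 4 * (E * E) * ‖ψ‖ ^ 2 at hE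
  have hC : 0 ≤ δ / s ^ 2 := by positivity
  refine ⟨?_, hm, ?_⟩
  · have h₁ : δ / 4 * J ≤ δ / 4 * (E * E * ‖ψ‖ ^ 2) := by
      have : 0 ≤ h ^ 2 / 2 * K := by positivity
      nlinarith
    calc J ≤ E * E * ‖ψ‖ ^ 2 := le_of_mul_le_mul_left h₁ (by positivity)
      _ ≤ (1 + δ / s ^ 2) * E * ‖ψ‖ ^ 2 := by
        gcongr
        linarith
  · have h₁ : h ^ 2 / 2 * K ≤ δ / 4 * (E * E) * ‖ψ‖ ^ 2 := by
      have : 0 ≤ 3 * δ / 4 * J := by positivity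
      linarith
    -- One of the two factors `E` is spent on `1/h²`; the other remains as the decay.
    have h₂ : 1 / h ^ 2 * E ≤ 2 / s ^ 2 := by
      calc 1 / h ^ 2 * E ≤ 2 / s ^ 2 * Real.exp (s / h) * E := by
            gcongr
            exact inv_sq_le_exp hs hh
        _ = 2 / s ^ 2 := by
            rw [mul_assoc, ← Real.exp_add, neg_div, add_neg_cancel, Real.exp_zero, mul_one]
    calc K = 2 * (1 / h ^ 2) * (h ^ 2 / 2 * K) := by field_simp
      _ ≤ 2 * (1 / h ^ 2) * (δ / 4 * (E * E) * ‖ψ‖ ^ 2) := by gcongr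
      _ = δ / 2 * (1 / h ^ 2 * E) * E * ‖ψ‖ ^ 2 := by ring
      _ ≤ δ / 2 * (2 / s ^ 2) * E * ‖ψ‖ ^ 2 := by gcongr
      _ = δ / s ^ 2 * E * ‖ψ‖ ^ 2 := by ring
      _ ≤ (1 + δ / s ^ 2) * E * ‖ψ‖ ^ 2 := by
        gcongr
        linarith
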